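/- All Banach spaces are real. Let $X,Y$ be Banach spaces and $W\neq\{0\}$ a Banach space. Equip $X\times Y^*$ with the norm $\|(x,y^*)\|=\|x\|+\|y^*\|$, put $\Gamma(p)=\{p,-p\}$ for $p\in X\times Y^*$, and let $d_H$ denote the Hausdorff distance, so that $d_H(\Gamma(p),\Gamma(q))=\min(\|p-q\|,\|p+q\|)$. Let $S_X$, $S_{Y^*}$ be the unit spheres and $B_{X^*}$, $B_Y$ the closed unit balls. Let $L\subseteq S_X\times S_{Y^*}$ be nonempty, closed, symmetric ($-L=L$) and with property $(P)$: for every sufficiently small $\varepsilon>0$ there is $\varpi(\varepsilon)>0$ such that for every $(x,y^*)\in L$ there is $(x^*_\varepsilon,y_\varepsilon)\in B_{X^*}\times B_Y$ with, for all $(z,t^*)\in L$, $$d_H(\Gamma(x,y^*),\Gamma(z,t^*))\ge\varepsilon\ \Longrightarrow\ x^*_\varepsilon(x)+y^*(y_\varepsilon)-\varpi(\varepsilon)\ge |x^*_\varepsilon(z)|+|t^*(y_\varepsilon)|.$$ Let $C_{b,e}(L,W)$ be the space of bounded continuous functions $\Phi:L\to W$ with $\Phi(-p)=\Phi(p)$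 for all $p\in L$, with the sup-norm $\|\cdot\|_\infty$. Let $\mathcal F(X,Y)$ be the space of finite rank bounded linear operators $T:X\to Y$. For $T\in\mathcal F(X,Y)$ and $w\in W$ let $[T]\oplus w$ be the map $(x,y^*)\mapsto y^*(T(x))\,w$ (restricted to $L$), and let $[\mathcal F(X,Y)]\oplus W=\{[T]\oplus w: T\in\mathcal F(X,Y),\ w\in W\}$. Let $(\mathcal Z,\|\cdot\|_{\mathcal Z})$ be a Banach space that is, as a vector space, a linear subspace of $C_{b,e}(L,W)$, such that (i) $\|\Phi\|_{\mathcal Z}\ge\|\Phi\|_\infty$ for all $\Phi\in\mathcal Z$; (ii) $[\mathcal F(X,Y)]\oplus W\subseteq\mathcal Z$ and $\|[T]\oplus w\|_{\mathcal Z}\le\|T\|\,\|w\|$ for all $T\in\mathcal F(X,Y)$, $w\in W$. We say that $\Phi\in C_{b,e}(L,W)$ attains $d_H$-strongly its maximum on $L$ if there is $p_0\in L$ with $\|\Phi(p_0)\|=\sup_{p\in L}\|\Phi(p)\|$ and such that $d_H(\Gamma(p_n),\Gamma(p_0))\to0$ for every sequence $(p_n)$ in $L$ with $\|\Phi(p_n)\|\to\sup_{p\in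 L}\|\Phi(p)\|$. Then for every sequence $(\Theta_n)$ in $\mathcal Z$ and every $\varepsilon>0$ there is $\Phi_\varepsilon$ in the $\|\cdot\|_{\mathcal Z}$-closure of the set $[\mathcal F(X,Y)]\oplus W$ such that $\|\Phi_\varepsilon\|_{\mathcal Z}<\varepsilon$ and, for every $n$, the function $\Theta_n+\Phi_\varepsilon$ attains $d_H$-strongly its maximum on $L$. -/

import Mathlib

open Filter Topology BoundedContinuousFunction

noncomputable section

namespace StrongMax

/-- A subset `L` of a real normed space is symmetric if `-L ⊆ L` (equivalently `-L = L`). -/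
def IsSymmetric {V : Type*} [NormedAddCommGroup V] (L : Set V) : Prop :=
  ∀ x ∈ L, -x ∈ L

/-- `d_H(Γ(x), Γ(y))`: the Hausdorff distance between `Γ(x) = {x, -x}` and `Γ(y) = {y, -y}`. -/
def dH {V : Type*} [NormedAddCommGroup V] (x y : V) : ℝ :=
  Metric.hausdorffDist ({x, -x} : Set V) ({y, -y} : Set V)

/-- The space of bounded continuous even functions on `L` with values in `W`; as a subspace of
`L →ᵇ W` it carries the sup-norm. -/
def evenBCF {V : Type*} [NormedAddCommGroup V] (L : Set V)
    (W : Type*) [NormedAddCommGroup W] [NormedSpace ℝ W] : Submodule ℝ (L →ᵇ W) where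
  carrier := {f | ∀ x y : L, (y : V) = -(x : V) → f y = f x}
  add_mem' := by
    intro f g hf hg x y h
    simp [hf x y h, hg x y h]
  zero_mem' := by
    intro x y _
    simp
  smul_mem' := by
    intro c f hf x y h
    simp [hf x y h]

/-- `Φ` attains `d_H`-strongly its maximum on `L`: the supremum of `‖Φ‖` is attained at some
`x₀ ∈ L`, and every maximizing sequence in `L` converges to `x₀` for `d_H`. -/
def AttainsDHStrongly {V : Type*} [NormedAddCommGroup V] {L : Set V}
    {W : Type*} [NormedAddCommGroup W] (Φ : L →ᵇ W) : Prop :=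
  ∃ x₀ : L, (⨆ x : L, ‖Φ x‖) = ‖Φ x₀‖ ∧
    ∀ u : ℕ → L, Tendsto (fun n => ‖Φ (u n)‖) atTop (𝓝 (⨆ x : L, ‖Φ x‖)) →
      Tendsto (fun n => dH (u n : V) (x₀ : V)) atTop (𝓝 0)

section Pair

variable (X Y : Type*) [NormedAddCommGroup X] [NormedSpace ℝ X]
  [NormedAddCommGroup Y] [NormedSpace ℝ Y]

/-- The space `X × Y*` with the norm `‖(x, y*)‖ = ‖x‖ + ‖y*‖`. -/
abbrev PairSpace : Type _ := WithLp 1 (X × StrongDual ℝ Y)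

/-- The product of unit spheres `S_X × S_{Y*}` as a subset of `X × Y*`. -/
def spheres : Set (PairSpace X Y) :=
  {p | ‖p.fst‖ = 1 ∧ ‖p.snd‖ = 1}

end Pair

section

variable {X Y W : Type*} [NormedAddCommGroup X] [NormedSpace ℝ X]
  [NormedAddCommGroup Y] [NormedSpace ℝ Y] [NormedAddCommGroup W] [NormedSpace ℝ W]

/-- Property `(P)` of a set `L ⊆ S_X × S_{Y*}`. -/
def PropertyP (L : Set (PairSpace X Y)) : Prop :=
  ∃ ε₀ : ℝ, 0 < ε₀ ∧ ∀ ε : ℝ, 0 < ε → ε < ε₀ →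
    ∃ ϖ : ℝ, 0 < ϖ ∧ ∀ p ∈ L,
      ∃ (f : StrongDual ℝ X) (y : Y), ‖f‖ ≤ 1 ∧ ‖y‖ ≤ 1 ∧
        ∀ q ∈ L, ε ≤ dH p q → |f q.fst| + |q.snd y| ≤ f p.fst + p.snd y - ϖ

/-- `T` has finite rank. -/
def IsFiniteRank (T : X →L[ℝ] Y) : Prop :=
  FiniteDimensional ℝ (LinearMap.range (T : X →ₗ[ℝ] Y))

/-- The map `[T] ⊕ w : X × Y* → W`, `(x, y*) ↦ y*(T x) w`. -/
def oplus (T : X →L[ℝ] Y) (w : W) (p : PairSpace X Y) : W :=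
  p.snd (T p.fst) • w

/-- The set `[𝓕(X,Y)] ⊕ W` of all maps `[T] ⊕ w` (restricted to `L`) with `T` of finite rank and
`w ∈ W`, as a subset of a space `Z` of functions on `L`, included in `C_{b,e}(L, W)` by `ι`. -/
def finiteRankOplus {L : Set (PairSpace X Y)} {Z : Type*} [NormedAddCommGroup Z]
    [NormedSpace ℝ Z] (ι : Z →ₗ[ℝ] evenBCF L W) : Set Z :=
  {z | ∃ (T : X →L[ℝ] Y) (w : W), IsFiniteRank T ∧ ∀ p : L, (ι z).1 p = oplus T w p.1}

end

end StrongMax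

end

/-! The closure of the elementary tensors is complete but in general not linear, so Baire category
is applied to it as a metric space, with a density step that moves both factors of a tensor. Having
a gap at scale `δ` is an open condition on the perturbation, and gaps at all scales give a strong
maximum (`attainsDHStrongly_of_hasGap`). Density is the real point.

Property (P) yields finite rank operators `R` peaking at any given point. Adding `±d R ⊗ w` to `Θ +
T ⊗ w` opens a gap unless almost norming functionals nearly vanish at `w`
(`exists_gap_of_not_flatAt`). This flatness cannot hold on a product of balls (`exists_not_flatAt`).
There `M(T, w) = sup ‖Θ + T ⊗ w‖` would have zero derivative in `T`, hence not depend on `T`.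
Scaling `T` amounts to scaling `w`, so `M(T₀, ·)` would be invariant under small dilations near
`w₀`, and convexity would make its growth at distance `s` from `w₀` along suitable scales `o(s)`.
But moving `T` so that it does not vanish at an almost norming point forces growth of order `s`. -/

namespace StrongMax

/-! ### Perturbation by elementary tensors: gaps away from flatness -/

section Perturbation

variable {P E W : Type*} [NormedAddCommGroup E] [NormedSpace ℝ E]
  [NormedAddCommGroup W] [NormedSpace ℝ W]

/-- The function `Θ` perturbed by the elementary tensor `e T ⊗ w`. -/
def perturb (Θ : P → W) (e : E →ₗ[ℝ] (P → ℝ)) (T : E) (w : W) (p : P) : W :=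
  Θ p + e T p • w

/-- The supremum of the norm of `perturb Θ e T w`. -/
noncomputable def perturbSup (Θ : P → W) (e : E →ₗ[ℝ] (P → ℝ)) (T : E) (w : W) : ℝ :=
  ⨆ p, ‖perturb Θ e T w p‖

/-- Functionals that almost norm the perturbed function at some point almost vanish at `w`. -/
def FlatAt (Θ : P → W) (e : E →ₗ[ℝ] (P → ℝ)) (T : E) (w : W) : Prop :=
  ∀ τ > 0, ∃ η > 0, ∀ (q : P) (f : StrongDual ℝ W), ‖f‖ ≤ 1 →
    perturbSup Θ e T w - η ≤ f (perturb Θ e T w q) → |f w| ≤ τ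

variable {Θ : P → W} {e : E →ₗ[ℝ] (P → ℝ)}

theorem le_of_norm_le_one {f : StrongDual ℝ W} (hf : ‖f‖ ≤ 1) (w : W) : |f w| ≤ ‖w‖ := by
  have := f.le_of_opNorm_le hf w
  simpa using this

theorem perturb_add_left (T H : E) (w : W) (p : P) :
    perturb Θ e (T + H) w p = perturb Θ e T w p + e H p • w := by
  simp [perturb, add_smul, add_assoc]

theorem perturb_add_right (T : E) (w u : W) (p : P) :
    perturb Θ e T (w + u) p = perturb Θ e T w p + e T p • u := by
  simp [perturb, add_assoc]

theorem perturbSup_smul_left (T : E) (w : W) (c : ℝ) :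
    perturbSup Θ e (c • T) w = perturbSup Θ e T (c • w) := by
  simp [perturbSup, perturb, mul_smul, smul_comm c]

theorem bddAbove_perturb (hΘ : ∃ C, ∀ p, ‖Θ p‖ ≤ C) (he : ∀ T p, |e T p| ≤ ‖T‖) (T : E) (w : W) :
    BddAbove (Set.range fun p => ‖perturb Θ e T w p‖) := by
  obtain ⟨C, hC⟩ := hΘ
  refine ⟨C + ‖T‖ * ‖w‖, ?_⟩
  rintro _ ⟨p, rfl⟩
  refine (norm_add_le _ _).trans (add_le_add (hC p) ?_)
  rw [norm_smul]
  exact mul_le_mul_of_nonneg_right (he T p) (norm_nonneg _)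

theorem norm_perturb_le_perturbSup (hΘ : ∃ C, ∀ p, ‖Θ p‖ ≤ C) (he : ∀ T p, |e T p| ≤ ‖T‖)
    (T : E) (w : W) (p : P) : ‖perturb Θ e T w p‖ ≤ perturbSup Θ e T w :=
  le_ciSup (bddAbove_perturb hΘ he T w) p

theorem apply_perturb_le_perturbSup (hΘ : ∃ C, ∀ p, ‖Θ p‖ ≤ C) (he : ∀ T p, |e T p| ≤ ‖T‖)
    (T : E) (w : W) (p : P) {f : StrongDual ℝ W} (hf : ‖f‖ ≤ 1) :
    f (perturb Θ e T w p) ≤ perturbSup Θ e T w :=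
  (le_abs_self _).trans <| (le_of_norm_le_one hf _).trans <|
    norm_perturb_le_perturbSup hΘ he T w p

theorem perturbSup_add_left_le [Nonempty P] (hΘ : ∃ C, ∀ p, ‖Θ p‖ ≤ C)
    (he : ∀ T p, |e T p| ≤ ‖T‖) (T H : E) (w : W) :
    perturbSup Θ e (T + H) w ≤ perturbSup Θ e T w + ‖H‖ * ‖w‖ := by
  refine ciSup_le fun p => ?_
  rw [perturb_add_left]
  refine (norm_add_le _ _).trans (add_le_add (norm_perturb_le_perturbSup hΘ he T w p) ?_)
  rw [norm_smul]
  exact mul_le_mul_of_nonneg_right (he H p) (norm_nonneg _)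

theorem exists_almost_norming [Nonempty P] (Θ : P → W) (e : E →ₗ[ℝ] (P → ℝ)) (T : E) (w : W)
    {η : ℝ} (hη : 0 < η) : ∃ p, perturbSup Θ e T w - η < ‖perturb Θ e T w p‖ :=
  exists_lt_of_lt_ciSup (sub_lt_self _ hη)

/-- At a point where the perturbed function is not flat, a small change of the operator alone
produces a strict gap. -/
theorem exists_gap_of_not_flatAt [Nonempty P] (hΘ : ∃ C, ∀ p, ‖Θ p‖ ≤ C)
    (he : ∀ T p, |e T p| ≤ ‖T‖) {far : P → P → Prop} {c : ℝ} (hc : 0 < c)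
    (hR : ∀ p, ∃ R : E, ‖R‖ ≤ 1 ∧ ∀ q, far p q → |e R q| + c ≤ e R p)
    {T : E} {w : W} (h : ¬ FlatAt Θ e T w) {δ : ℝ} (hδ : 0 < δ) :
    ∃ T' : E, ‖T' - T‖ < δ ∧ ∃ p, ∃ γ > 0, ∀ q, far p q →
      ‖perturb Θ e T' w q‖ + γ ≤ ‖perturb Θ e T' w p‖ := by
  set M := perturbSup Θ e T w with hM
  let S : Set ℝ := {τ | ∀ η > 0, ∃ (q : P) (f : StrongDual ℝ W), ‖f‖ ≤ 1 ∧
    M - η ≤ f (perturb Θ e T w q) ∧ τ < |f w|}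
  obtain ⟨τ₀, hτ₀, hτ₀S⟩ : ∃ τ₀ > 0, τ₀ ∈ S := by
    simp only [FlatAt, not_forall, not_exists, not_and, not_le] at h
    obtain ⟨τ, hτ, h⟩ := h
    refine ⟨τ, hτ, fun η hη => ?_⟩
    obtain ⟨q, f, h1, h2, h3⟩ := h η hη
    exact ⟨q, f, h1, h2, h3⟩
  have hSb : BddAbove S := by
    refine ⟨‖w‖, fun τ hτ => ?_⟩
    obtain ⟨q, f, h1, -, h3⟩ := hτ 1 one_pos
    exact h3.le.trans (le_of_norm_le_one h1 w)
  -- `κ` is the limit, as `η → 0`, of the supremum of `|f w|` over functionals `f` that norm up to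
  -- `η`.
  set κ := sSup S
  have hκ : 0 < κ := hτ₀.trans_le (le_csSup hSb hτ₀S)
  have hσ : 0 < κ * c / 8 := by positivity
  set σ := κ * c / 8 with hσd
  obtain ⟨τ₁, hτ₁S, hτ₁⟩ : ∃ τ ∈ S, κ - σ < τ :=
    exists_lt_of_lt_csSup ⟨τ₀, hτ₀S⟩ (sub_lt_self _ hσ)
  obtain ⟨η, hη, hup⟩ : ∃ η > 0, ∀ (q : P) (f : StrongDual ℝ W), ‖f‖ ≤ 1 →
      M - η ≤ f (perturb Θ e T w q) → |f w| ≤ κ + σ := by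
    have : κ + σ ∉ S := fun h => by linarith [le_csSup hSb h]
    simp only [S, Set.mem_ofPred_eq, not_forall, not_exists, not_and, not_lt] at this
    obtain ⟨η, hη, h⟩ := this
    exact ⟨η, hη, h⟩
  -- The perturbation is too small to lift a functional that is not `η`-almost norming up to the new
  -- value at `p`.
  obtain ⟨d, hd, hdδ, hdη⟩ : ∃ d > 0, d < δ ∧ d * ‖w‖ ≤ η / 4 := by
    refine ⟨min (δ / 2) (η / (4 * (‖w‖ + 1))), by positivity, ?_, ?_⟩
    · exact (min_le_left _ _).trans_lt (by linarith)
    · calc _ ≤ η / (4 * (‖w‖ + 1)) * ‖w‖ := by gcongr; exact min_le_right _ _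
        _ ≤ η / (4 * (‖w‖ + 1)) * (‖w‖ + 1) := by gcongr; linarith
        _ = η / 4 := by field_simp
  obtain ⟨p, f, hf1, hfM, hfw⟩ := hτ₁S (min (η / 2) (d * κ * c / 8)) (by positivity)
  have hη1 := min_le_left (η / 2) (d * κ * c / 8)
  have hη2 := min_le_right (η / 2) (d * κ * c / 8)
  obtain ⟨R, hR1, hR⟩ := hR p
  obtain ⟨s, hs, hsf⟩ : ∃ s : ℝ, |s| = 1 ∧ s * f w = |f w| := by
    rcases abs_cases (f w) with ⟨h, -⟩ | ⟨h, -⟩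
    · exact ⟨1, by simp, by rw [h, one_mul]⟩
    · exact ⟨-1, by simp, by rw [h, neg_one_mul]⟩
  have heR : ∀ q, |e R q| ≤ 1 := fun q => (he R q).trans hR1
  refine ⟨T + (s * d) • R, ?_, p, min (η / 4) (d * κ * c / 2), by positivity, fun q hq => ?_⟩
  · rw [add_sub_cancel_left, norm_smul, Real.norm_eq_abs, abs_mul, hs, one_mul, abs_of_pos hd]
    exact (mul_le_of_le_one_right hd.le hR1).trans_lt hdδ
  have hpq := hR q hq
  have hRp : e R p ≤ 1 := (le_abs_self _).trans (heR p)
  have hRq := abs_nonneg (e R q)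
  have hval : ∀ (g : StrongDual ℝ W) x, g (perturb Θ e (T + (s * d) • R) w x) =
      g (perturb Θ e T w x) + s * d * e R x * g w := by
    intro g x
    simp [perturb_add_left, mul_assoc]
  have hp : M - min (η / 2) (d * κ * c / 8) + d * e R p * (κ - σ) ≤
      ‖perturb Θ e (T + (s * d) • R) w p‖ := by
    refine le_trans ?_ ((le_abs_self _).trans (le_of_norm_le_one hf1 _))
    rw [hval, show s * d * e R p * f w = d * e R p * (s * f w) by ring, hsf]
    have : 0 ≤ d * e R p := mul_nonneg hd.le (by linarith)
    have := mul_le_mul_of_nonneg_left (hτ₁.trans hfw).le this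
    linarith
  obtain ⟨g, hg1, hg⟩ := exists_dual_vector'' ℝ (perturb Θ e (T + (s * d) • R) w q)
  have hg' : ‖perturb Θ e (T + (s * d) • R) w q‖ ≤
      g (perturb Θ e T w q) + d * |e R q| * |g w| := by
    have h1 : s * d * e R q * g w ≤ d * |e R q| * |g w| := by
      refine (le_abs_self _).trans_eq ?_
      rw [abs_mul, abs_mul, abs_mul, hs, one_mul, abs_of_pos hd]
    have h2 := hval g q
    rw [hg] at h2
    simp only [RCLike.ofReal_real_eq_id, id] at h2
    linarith
  have hcle : c ≤ 1 := by linarith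
  have hσκ : σ ≤ κ := by rw [hσd]; nlinarith
  -- If `g` is `η`-almost norming, its slope `|g w|` is at most `κ + σ` and peaking of `R` gives the
  -- gap; otherwise the deficit `η` gives it.
  rcases le_or_gt (M - η) (g (perturb Θ e T w q)) with hcase | hcase
  · have h1 := hup q g hg1 hcase
    have h2 := apply_perturb_le_perturbSup hΘ he T w q hg1
    have h3 : d * |e R q| * |g w| ≤ d * |e R q| * (κ + σ) := by gcongr
    have h4 := min_le_right (η / 4) (d * κ * c / 2)
    have h5 : d * (|e R q| * (κ + σ)) + d * κ * c * (3 / 4) ≤ d * (e R p * (κ - σ)) := by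
      have : |e R q| * (κ + σ) + κ * c * (3 / 4) ≤ e R p * (κ - σ) := by
        have h6 : (|e R q| + c) * κ ≤ e R p * κ := by gcongr
        have h7 : |e R q| * σ ≤ 1 * σ := mul_le_mul_of_nonneg_right (heR q) hσ.le
        have h8 : e R p * σ ≤ 1 * σ := mul_le_mul_of_nonneg_right hRp hσ.le
        linarith
      have := mul_le_mul_of_nonneg_left this hd.le
      linarith
    have h9 : 0 < d * κ * c := by positivity
    linarith
  · have h1 : d * |e R q| * |g w| ≤ d * 1 * ‖w‖ := by
      gcongr
      exacts [heR q, le_of_norm_le_one hg1 w]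
    have h2 : 0 ≤ d * e R p * (κ - σ) :=
      mul_nonneg (mul_nonneg hd.le (by linarith)) (by linarith)
    have h4 := min_le_left (η / 4) (d * κ * c / 2)
    linarith

end Perturbation

end StrongMax

namespace StrongMax

/-! ### Flatness cannot hold on an open set -/

section Flat

variable {P E W : Type*} [NormedAddCommGroup E] [NormedSpace ℝ E]
  [NormedAddCommGroup W] [NormedSpace ℝ W] {Θ : P → W} {e : E →ₗ[ℝ] (P → ℝ)}

theorem two_mul_perturbSup_le_left [Nonempty P] (hΘ : ∃ C, ∀ p, ‖Θ p‖ ≤ C)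
    (he : ∀ T p, |e T p| ≤ ‖T‖) (T H : E) (w : W) :
    2 * perturbSup Θ e T w ≤ perturbSup Θ e (T + H) w + perturbSup Θ e (T - H) w := by
  suffices perturbSup Θ e T w ≤
      (perturbSup Θ e (T + H) w + perturbSup Θ e (T - H) w) / 2 by linarith
  refine ciSup_le fun p => ?_
  have h1 := norm_perturb_le_perturbSup hΘ he (T + H) w p
  have h2 := norm_perturb_le_perturbSup hΘ he (T - H) w p
  have h3 : (2 : ℝ) • perturb Θ e T w p = perturb Θ e (T + H) w p + perturb Θ e (T - H) w p := by
    simp only [perturb, map_add, map_sub, Pi.add_apply, Pi.sub_apply]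
    module
  have h4 := norm_add_le (perturb Θ e (T + H) w p) (perturb Θ e (T - H) w p)
  rw [← h3, norm_smul, Real.norm_ofNat] at h4
  linarith

theorem two_mul_perturbSup_le_right [Nonempty P] (hΘ : ∃ C, ∀ p, ‖Θ p‖ ≤ C)
    (he : ∀ T p, |e T p| ≤ ‖T‖) (T : E) {w x y : W} (h : (2 : ℝ) • w = x + y) :
    2 * perturbSup Θ e T w ≤ perturbSup Θ e T x + perturbSup Θ e T y := by
  suffices perturbSup Θ e T w ≤ (perturbSup Θ e T x + perturbSup Θ e T y) / 2 by linarith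
  refine ciSup_le fun p => ?_
  have h1 := norm_perturb_le_perturbSup hΘ he T x p
  have h2 := norm_perturb_le_perturbSup hΘ he T y p
  have h3 : (2 : ℝ) • perturb Θ e T w p = perturb Θ e T x p + perturb Θ e T y p := by
    have : perturb Θ e T x p + perturb Θ e T y p = (2 : ℝ) • Θ p + e T p • (x + y) := by
      simp only [perturb]
      module
    rw [this, ← h]
    simp only [perturb]
    module
  have h4 := norm_add_le (perturb Θ e T x p) (perturb Θ e T y p)
  rw [← h3, norm_smul, Real.norm_ofNat] at h4
  linarith

/-- A functional almost norming after a small change `H` was almost norming before it, so by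
flatness it gains at most `τ * ‖H‖`. Midpoint convexity turns this upper bound for `-H` into the
lower bound for `H`. -/
theorem FlatAt.hasFDerivAt [Nonempty P] (hΘ : ∃ C, ∀ p, ‖Θ p‖ ≤ C)
    (he : ∀ T p, |e T p| ≤ ‖T‖) {T : E} {w : W} (h : FlatAt Θ e T w) :
    HasFDerivAt (fun T => perturbSup Θ e T w) (0 : E →L[ℝ] ℝ) T := by
  rw [hasFDerivAt_iff_isLittleO_nhds_zero, Asymptotics.isLittleO_iff]
  intro τ hτ
  obtain ⟨η, hη, hflat⟩ := h τ hτ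
  have key : ∀ H : E, ‖H‖ * ‖w‖ ≤ η / 4 →
      perturbSup Θ e (T + H) w ≤ perturbSup Θ e T w + τ * ‖H‖ := by
    intro H hH
    refine le_of_forall_pos_le_add fun ζ hζ => ?_
    obtain ⟨q, hq⟩ := exists_almost_norming Θ e (T + H) w (lt_min (half_pos hη) hζ)
    obtain ⟨g, hg1, hg⟩ := exists_dual_vector'' ℝ (perturb Θ e (T + H) w q)
    simp only [RCLike.ofReal_real_eq_id, id] at hg
    rw [← hg, perturb_add_left, map_add, map_smul, smul_eq_mul] at hq
    have h1 := min_le_left (η / 2) ζ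
    have h2 := min_le_right (η / 2) ζ
    have h3 : |e H q * g w| ≤ ‖H‖ * |g w| := by
      rw [abs_mul]
      exact mul_le_mul_of_nonneg_right (he H q) (abs_nonneg _)
    have h4 : ‖H‖ * |g w| ≤ ‖H‖ * ‖w‖ := by
      gcongr
      exact le_of_norm_le_one hg1 w
    have h5 := perturbSup_add_left_le hΘ he (T + H) (-H) w
    rw [add_neg_cancel_right, norm_neg] at h5
    have h6 := le_abs_self (e H q * g w)
    have h7 := hflat q g hg1 (by linarith)
    have h8 : ‖H‖ * |g w| ≤ ‖H‖ * τ := by gcongr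
    have h9 := apply_perturb_le_perturbSup hΘ he T w q hg1
    linarith
  have hsmall : ∀ᶠ H : E in 𝓝 0, ‖H‖ * ‖w‖ ≤ η / 4 := by
    have : Tendsto (fun H : E => ‖H‖ * ‖w‖) (𝓝 0) (𝓝 (‖(0 : E)‖ * ‖w‖)) := by
      apply Continuous.tendsto
      fun_prop
    rw [norm_zero, zero_mul] at this
    exact this.eventually (Iic_mem_nhds (by positivity))
  filter_upwards [hsmall] with H hH
  have h1 := key H hH
  have h2 := key (-H) (by rwa [norm_neg])
  rw [norm_neg, ← sub_eq_add_neg] at h2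
  have h3 := two_mul_perturbSup_le_left hΘ he T H w
  rw [zero_apply, sub_zero, Real.norm_eq_abs, abs_le]
  constructor <;> linarith

theorem perturbSup_eq_of_flatAt [Nonempty P] (hΘ : ∃ C, ∀ p, ‖Θ p‖ ≤ C)
    (he : ∀ T p, |e T p| ≤ ‖T‖) {T₀ : E} {w : W} {r : ℝ}
    (h : ∀ T ∈ Metric.ball T₀ r, FlatAt Θ e T w) {T : E} (hT : T ∈ Metric.ball T₀ r) :
    perturbSup Θ e T w = perturbSup Θ e T₀ w := by
  have hr : T₀ ∈ Metric.ball T₀ r :=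
    Metric.mem_ball_self (dist_nonneg.trans_lt (Metric.mem_ball.1 hT))
  refine Metric.isOpen_ball.is_const_of_fderiv_eq_zero (𝕜 := ℝ)
    (f := fun T => perturbSup Θ e T w) (convex_ball T₀ r).isPreconnected
    (fun x hx => (FlatAt.hasFDerivAt hΘ he (h x hx)).differentiableAt.differentiableWithinAt)
    (fun x hx => (FlatAt.hasFDerivAt hΘ he (h x hx)).fderiv) hT hr

theorem exists_norm_one_norming [Nontrivial W] (v : W) :
    ∃ (f : StrongDual ℝ W) (u : W), ‖f‖ ≤ 1 ∧ ‖u‖ ≤ 1 ∧ f v = ‖v‖ ∧ f u = 1 := by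
  by_cases hv : v = 0
  · obtain ⟨u, hu⟩ := exists_norm_eq W zero_le_one
    obtain ⟨f, hf1, hf⟩ := exists_dual_vector'' ℝ u
    exact ⟨f, u, hf1, hu.le, by simp [hv], by simpa [hu] using hf⟩
  · obtain ⟨f, hf1, hf⟩ := exists_dual_vector'' ℝ v
    simp only [RCLike.ofReal_real_eq_id, id] at hf
    refine ⟨f, ‖v‖⁻¹ • v, hf1, ?_, hf, ?_⟩
    · simp [norm_smul, norm_ne_zero_iff.2 hv]
    · simp [hf, norm_ne_zero_iff.2 hv]

/-- The perturbed function cannot be flat on a neighbourhood of a pair `(T₀, w₀)`. -/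
theorem exists_not_flatAt [Nonempty P] [Nontrivial W] (hΘ : ∃ C, ∀ p, ‖Θ p‖ ≤ C)
    (he : ∀ T p, |e T p| ≤ ‖T‖) {c : ℝ} (hc : 0 < c) (hR : ∀ p, ∃ R : E, ‖R‖ ≤ 1 ∧ c ≤ |e R p|)
    (T₀ : E) (w₀ : W) {r : ℝ} (hr : 0 < r) :
    ∃ T ∈ Metric.ball T₀ r, ∃ w ∈ Metric.ball w₀ r, ¬ FlatAt Θ e T w := by
  by_contra! hflat
  have hconst : ∀ T ∈ Metric.ball T₀ r, ∀ w ∈ Metric.ball w₀ r,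
      perturbSup Θ e T w = perturbSup Θ e T₀ w := fun T hT w hw =>
    perturbSup_eq_of_flatAt hΘ he (fun T hT => hflat T hT w hw) hT
  have hmem : ∀ {x : W} {s : ℝ}, 0 ≤ s → s < r → ‖x‖ ≤ 1 → w₀ + s • x ∈ Metric.ball w₀ r := by
    intro x s hs hsr hx
    rw [mem_ball_iff_norm, add_sub_cancel_left, norm_smul, Real.norm_of_nonneg hs]
    exact (mul_le_of_le_one_right hs hx).trans_lt hsr
  set φ : ℝ → W → ℝ := fun s u => perturbSup Θ e T₀ (w₀ + s • u) - perturbSup Θ e T₀ w₀ with hφ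
  -- linear growth in some direction
  have hgrow : ∃ c' > 0, ∀ s, 0 < s → s < r → ∃ u, ‖u‖ ≤ 1 ∧ c' * s ≤ φ s u := by
    -- The gain is at least `s * (r / 2 * c)`; the norming defect and the cost of moving `T₀` each
    -- use up at most a quarter of that.
    refine ⟨r / 2 * c / 2, by positivity, fun s hs hsr => ?_⟩
    obtain ⟨τ, hτ, hτs⟩ : ∃ τ > 0, r / 2 * τ ≤ r / 2 * c / 4 * s :=
      ⟨c / 4 * s, by positivity, by linarith⟩
    obtain ⟨η, hη, hfl⟩ := hflat T₀ (Metric.mem_ball_self hr) w₀ (Metric.mem_ball_self hr) τ hτ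
    obtain ⟨p, hp⟩ := exists_almost_norming Θ e T₀ w₀
      (lt_min hη (show 0 < r / 2 * c / 4 * s by positivity))
    have hm1 := min_le_left η (r / 2 * c / 4 * s)
    have hm2 := min_le_right η (r / 2 * c / 4 * s)
    obtain ⟨f, u, hf1, hu1, hfv, hfu⟩ := exists_norm_one_norming (perturb Θ e T₀ w₀ p)
    obtain ⟨R, hR1, hRp⟩ := hR p
    obtain ⟨T, hT, hTp⟩ : ∃ H : E, ‖H‖ ≤ r / 2 ∧ r / 2 * c ≤ |e (T₀ + H) p| := by
      have hn : ∀ t : ℝ, |t| = 1 → ‖(t * (r / 2)) • R‖ ≤ r / 2 := by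
        intro t ht
        rw [norm_smul, Real.norm_eq_abs, abs_mul, ht, one_mul, abs_of_pos (half_pos hr)]
        exact mul_le_of_le_one_right (half_pos hr).le hR1
      -- The values at `T₀ ± (r / 2) • R` differ by `r * e R p`, so they cannot both be small.
      by_contra! hcon
      have h1 := hcon _ (hn 1 (by simp))
      have h2 := hcon _ (hn (-1) (by simp))
      simp only [map_add, map_smul, Pi.add_apply, Pi.smul_apply, smul_eq_mul] at h1 h2
      have h3 : r / 2 * c ≤ |r / 2 * e R p| := by
        rw [abs_mul, abs_of_pos (half_pos hr)]
        gcongr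
      rw [abs_lt] at h1 h2
      have : |r / 2 * e R p| < r / 2 * c := by
        rw [abs_lt]
        constructor <;> linarith
      linarith
    obtain ⟨t, ht, htT⟩ : ∃ t : ℝ, |t| = 1 ∧ t * e (T₀ + T) p = |e (T₀ + T) p| := by
      rcases abs_cases (e (T₀ + T) p) with ⟨h, -⟩ | ⟨h, -⟩
      · exact ⟨1, by simp, by rw [h, one_mul]⟩
      · exact ⟨-1, by simp, by rw [h, neg_one_mul]⟩
    have htu : ‖t • u‖ ≤ 1 := by rwa [norm_smul, Real.norm_eq_abs, ht, one_mul]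
    refine ⟨t • u, htu, ?_⟩
    have hT' : T₀ + T ∈ Metric.ball T₀ r := by
      rw [mem_ball_iff_norm, add_sub_cancel_left]
      linarith
    rw [hφ]
    dsimp only
    -- Replacing `T₀` by `T₀ + T` is free, since the supremum does not depend on the operator here.
    rw [← hconst _ hT' _ (hmem hs.le hsr htu)]
    have h1 := apply_perturb_le_perturbSup hΘ he (T₀ + T) (w₀ + s • t • u) p hf1
    rw [perturb_add_right, perturb_add_left] at h1
    simp only [map_add f, map_smul, smul_eq_mul, hfv, hfu, mul_one] at h1
    have h2 := hfl p f hf1 (by linarith)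
    have h3 : |e T p * f w₀| ≤ r / 2 * τ := by
      rw [abs_mul]
      exact mul_le_mul ((he T p).trans hT) h2 (abs_nonneg _) (half_pos hr).le
    have h4 := neg_abs_le (e T p * f w₀)
    have h5 : e (T₀ + T) p * (s * t) = s * |e (T₀ + T) p| := by rw [← htT]; ring
    have h6 : s * (r / 2 * c) ≤ s * |e (T₀ + T) p| := by gcongr
    linarith
  -- invariance under a small dilation
  obtain ⟨b, hb, hbT⟩ : ∃ b > 0, b * ‖T₀‖ < r := by
    refine ⟨r / (‖T₀‖ + 1), by positivity, ?_⟩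
    rw [div_mul_eq_mul_div, div_lt_iff₀ (by positivity)]
    nlinarith
  have hdil : ∀ a, 0 ≤ a → a ≤ b → ∀ x ∈ Metric.ball w₀ r,
      perturbSup Θ e T₀ ((1 + a) • x) = perturbSup Θ e T₀ x := by
    intro a ha hab x hx
    rw [← perturbSup_smul_left]
    refine hconst _ ?_ x hx
    rw [mem_ball_iff_norm, add_smul, one_smul, add_sub_cancel_left, norm_smul,
      Real.norm_of_nonneg ha]
    exact (mul_le_mul_of_nonneg_right hab (norm_nonneg _)).trans_lt hbT
  -- The midpoint of `w₀` and `(1 + b) • (w₀ + s • u)` is `(1 + b / 2) • (w₀ + (θ * s) • u)`. Both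
  -- dilations are harmless, so convexity halves `φ` while `s` shrinks only by `θ > 1 / 2`.
  set θ := (1 + b) / (2 + b) with hθ
  have hθ0 : 0 < θ := by positivity
  have hθ1 : θ < 1 := by rw [hθ, div_lt_one (by positivity)]; linarith
  have hθ2 : 1 < 2 * θ := by rw [hθ, ← mul_div_assoc, one_lt_div (by positivity)]; linarith
  have hcontr : ∀ s, 0 ≤ s → s < r → ∀ u, ‖u‖ ≤ 1 → 2 * φ (θ * s) u ≤ φ s u := by
    intro s hs hsr u hu
    have hθs : θ * s ≤ s := mul_le_of_le_one_left hs hθ1.le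
    have h1 := two_mul_perturbSup_le_right hΘ he T₀ (w := (1 + b / 2) • (w₀ + (θ * s) • u))
      (x := w₀) (y := (1 + b) • (w₀ + s • u)) (by
        have : (2 + b) * θ = 1 + b := by rw [hθ]; field_simp
        have h2 : (2 : ℝ) • (1 + b / 2) • (w₀ + (θ * s) • u) =
            (2 + b) • w₀ + (((2 + b) * θ) * s) • u := by module
        rw [h2, this]
        module)
    rw [hdil _ (by positivity) (by linarith) _ (hmem (by positivity) (by linarith) hu),
      hdil _ hb.le le_rfl _ (hmem hs hsr hu)] at h1
    simp only [hφ]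
    linarith
  have hiter : ∀ (k : ℕ) u, ‖u‖ ≤ 1 → 2 ^ k * φ (θ ^ k * (r / 2)) u ≤ φ (r / 2) u := by
    intro k u hu
    induction k with
    | zero => simp
    | succ k ih =>
      have h1 : θ ^ k * (r / 2) ≤ r / 2 :=
        mul_le_of_le_one_left (by positivity) (pow_le_one₀ hθ0.le hθ1.le)
      have h2 := hcontr (θ ^ k * (r / 2)) (by positivity) (by linarith) u hu
      rw [← mul_assoc, ← pow_succ'] at h2
      have h3 := mul_le_mul_of_nonneg_left h2 (show (0 : ℝ) ≤ 2 ^ k by positivity)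
      rw [pow_succ 2 k]
      linarith
  obtain ⟨B, hB⟩ : ∃ B, ∀ u, ‖u‖ ≤ 1 → φ (r / 2) u ≤ B := by
    refine ⟨‖T₀‖ * (r / 2), fun u hu => ?_⟩
    rw [hφ]
    dsimp only
    rw [sub_le_iff_le_add]
    refine ciSup_le fun p => ?_
    rw [perturb_add_right, add_comm]
    refine (norm_add_le _ _).trans (add_le_add ?_ (norm_perturb_le_perturbSup hΘ he T₀ w₀ p))
    rw [norm_smul, norm_smul, Real.norm_of_nonneg (half_pos hr).le]
    exact mul_le_mul (he T₀ p) (mul_le_of_le_one_right (half_pos hr).le hu) (by positivity)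
      (norm_nonneg _)
  obtain ⟨c', hc', hg⟩ := hgrow
  obtain ⟨k, hk⟩ := pow_unbounded_of_one_lt (B / (c' * (r / 2))) hθ2
  rw [div_lt_iff₀ (by positivity)] at hk
  have h1 : θ ^ k * (r / 2) ≤ r / 2 :=
    mul_le_of_le_one_left (by positivity) (pow_le_one₀ hθ0.le hθ1.le)
  obtain ⟨u, hu, hgu⟩ := hg (θ ^ k * (r / 2)) (by positivity) (by linarith)
  have h2 := hiter k u hu
  have h3 := mul_le_mul_of_nonneg_left hgu (show (0 : ℝ) ≤ 2 ^ k by positivity)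
  have h4 := hB u hu
  rw [mul_pow] at hk
  linarith

/-- Perturbing both factors of an elementary tensor slightly produces a strict gap. -/
theorem exists_gap [Nonempty P] [Nontrivial W] (hΘ : ∃ C, ∀ p, ‖Θ p‖ ≤ C)
    (he : ∀ T p, |e T p| ≤ ‖T‖) {far : P → P → Prop} {c c' : ℝ} (hc : 0 < c) (hc' : 0 < c')
    (hR : ∀ p, ∃ R : E, ‖R‖ ≤ 1 ∧ ∀ q, far p q → |e R q| + c ≤ e R p)
    (hR' : ∀ p, ∃ R : E, ‖R‖ ≤ 1 ∧ c' ≤ |e R p|)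
    (T₀ : E) (w₀ : W) {r : ℝ} (hr : 0 < r) :
    ∃ (T : E) (w : W), ‖T - T₀‖ < r ∧ ‖w - w₀‖ < r ∧ ∃ p, ∃ γ > 0, ∀ q, far p q →
      ‖perturb Θ e T w q‖ + γ ≤ ‖perturb Θ e T w p‖ := by
  obtain ⟨T, hT, w, hw, hflat⟩ := exists_not_flatAt hΘ he hc' hR' T₀ w₀ (half_pos hr)
  obtain ⟨T', hT', hgap⟩ := exists_gap_of_not_flatAt hΘ he hc hR hflat (half_pos hr)
  rw [mem_ball_iff_norm] at hT hw
  refine ⟨T', w, ?_, by linarith, hgap⟩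
  have := norm_sub_le_norm_sub_add_norm_sub T' T T₀
  linarith

end Flat

end StrongMax

namespace StrongMax

/-! ### Gaps at all scales give strong maxima -/

section Gap

variable {V W : Type*} [NormedAddCommGroup V] [NormedAddCommGroup W]

theorem dH_nonneg (x y : V) : 0 ≤ dH x y :=
  Metric.hausdorffDist_nonneg

theorem dH_comm (x y : V) : dH x y = dH y x :=
  Metric.hausdorffDist_comm

theorem hausdorffEDist_pair_ne_top (x y : V) :
    Metric.hausdorffEDist ({x, -x} : Set V) ({y, -y} : Set V) ≠ ⊤ :=
  Metric.hausdorffEDist_ne_top_of_nonempty_of_bounded (Set.insert_nonempty _ _)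
    (Set.insert_nonempty _ _) (Set.toFinite _).isBounded (Set.toFinite _).isBounded

theorem dH_triangle (x y z : V) : dH x z ≤ dH x y + dH y z :=
  Metric.hausdorffDist_triangle (hausdorffEDist_pair_ne_top x y)

theorem dist_lt_or_of_dH_lt {x y : V} {r : ℝ} (h : dH x y < r) : dist y x < r ∨ dist y (-x) < r := by
  obtain ⟨z, hz, hyz⟩ := Metric.exists_dist_lt_of_hausdorffDist_lt' (y := y)
    (Set.mem_insert _ _) h (hausdorffEDist_pair_ne_top x y)
  rcases hz with rfl | rfl
  · exact Or.inl (by rwa [dist_comm])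
  · exact Or.inr (by rwa [dist_comm])

/-- At some point `p`, the function `‖Φ‖` exceeds by a fixed amount its values at all points at
`d_H`-distance at least `δ` from `p`. -/
def HasGap {L : Set V} (Φ : L →ᵇ W) (δ : ℝ) : Prop :=
  ∃ p : L, ∃ γ > 0, ∀ q : L, δ ≤ dH (p : V) (q : V) → ‖Φ q‖ + γ ≤ ‖Φ p‖

variable {L : Set V} {Φ Ψ : L →ᵇ W} {δ δ' : ℝ}

theorem HasGap.mono (h : HasGap Φ δ) (hδ : δ ≤ δ') : HasGap Φ δ' := by
  obtain ⟨p, γ, hγ, h⟩ := h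
  exact ⟨p, γ, hγ, fun q hq => h q (hδ.trans hq)⟩

theorem HasGap.exists_forall_norm_sub_lt (h : HasGap Φ δ) :
    ∃ ρ > 0, ∀ Ψ : L →ᵇ W, ‖Ψ - Φ‖ < ρ → HasGap Ψ δ := by
  obtain ⟨p, γ, hγ, h⟩ := h
  refine ⟨γ / 4, by positivity, fun Ψ hΨ => ⟨p, γ / 2, by positivity, fun q hq => ?_⟩⟩
  have h1 := h q hq
  have h2 := (Ψ - Φ).norm_coe_le_norm q
  have h3 := (Ψ - Φ).norm_coe_le_norm p
  rw [BoundedContinuousFunction.sub_apply] at h2 h3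
  have h4 := norm_sub_norm_le (Ψ q) (Φ q)
  have h5 := norm_sub_norm_le (Φ p) (Ψ p)
  rw [norm_sub_rev] at h5
  linarith

/-- At each scale a maximizing sequence eventually stays near `{p, -p}`, so its range is totally
bounded and a subsequence converges in `L`. The limit is a maximizer, and the gaps keep every
maximizing sequence close to it. -/
theorem attainsDHStrongly_of_hasGap [CompleteSpace V] (hL : IsClosed L)
    (h : ∀ δ > 0, HasGap Φ δ) : AttainsDHStrongly Φ := by
  have hb : BddAbove (Set.range fun x : L => ‖Φ x‖) :=
    ⟨‖Φ‖, by rintro _ ⟨x, rfl⟩; exact Φ.norm_coe_le_norm x⟩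
  have : Nonempty L := ⟨(h 1 one_pos).choose⟩
  unfold AttainsDHStrongly
  set s := ⨆ x : L, ‖Φ x‖ with hs
  have hnear : ∀ δ > 0, ∃ p : L, ∃ a < s, ∀ q : L, a < ‖Φ q‖ → dH (p : V) (q : V) < δ := by
    intro δ hδ
    obtain ⟨p, γ, hγ, hp⟩ := h δ hδ
    refine ⟨p, s - γ, sub_lt_self _ hγ, fun q hq => ?_⟩
    by_contra! hcon
    have h1 := hp q hcon
    have h2 : ‖Φ p‖ ≤ s := le_ciSup hb p
    linarith
  obtain ⟨u, hu⟩ : ∃ u : ℕ → L, Tendsto (fun n => ‖Φ (u n)‖) atTop (𝓝 s) := by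
    obtain ⟨v, -, hv, hvmem⟩ := exists_seq_tendsto_sSup (Set.range_nonempty _) hb
    choose u hu using hvmem
    refine ⟨u, ?_⟩
    simp only [hu]
    exact hv
  have htb : TotallyBounded (Set.range fun n => (u n : V)) := by
    rw [Metric.totallyBounded_iff]
    intro δ hδ
    obtain ⟨p, a, ha, hp⟩ := hnear δ hδ
    obtain ⟨N, hN⟩ := eventually_atTop.1 (hu.eventually (Ioi_mem_nhds ha))
    refine ⟨{(p : V), -(p : V)} ∪ (fun n => (u n : V)) '' Set.Iio N,
      (Set.toFinite _).union ((Set.finite_Iio N).image _), ?_⟩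
    rintro _ ⟨n, rfl⟩
    simp only [Set.mem_iUnion, Metric.mem_ball, exists_prop]
    rcases lt_or_ge n N with hn | hn
    · exact ⟨u n, Or.inr ⟨n, hn, rfl⟩, by simpa using hδ⟩
    · rcases dist_lt_or_of_dH_lt (hp (u n) (hN n hn)) with hd | hd
      · exact ⟨p, Or.inl (by simp), hd⟩
      · exact ⟨-p, Or.inl (by simp), hd⟩
  obtain ⟨a, -, φ, hφ, hlim⟩ := (htb.closure.isCompact_of_isClosed
    isClosed_closure).tendsto_subseq (x := fun n => (u n : V))
    (fun n => subset_closure (Set.mem_range_self n))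
  have haL : a ∈ L := hL.mem_of_tendsto hlim (Eventually.of_forall fun n => (u (φ n)).2)
  have hlim' : Tendsto (fun n => u (φ n)) atTop (𝓝 ⟨a, haL⟩) := tendsto_subtype_rng.2 hlim
  have hmax : s = ‖Φ ⟨a, haL⟩‖ :=
    tendsto_nhds_unique (hu.comp hφ.tendsto_atTop)
      (((Φ.continuous.norm).tendsto _).comp hlim')
  refine ⟨⟨a, haL⟩, hmax, fun u' hu' => ?_⟩
  rw [Metric.tendsto_atTop]
  intro δ hδ
  obtain ⟨p, b, hbs, hp⟩ := hnear (δ / 2) (half_pos hδ)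
  obtain ⟨N, hN⟩ := eventually_atTop.1 (hu'.eventually (Ioi_mem_nhds hbs))
  refine ⟨N, fun n hn => ?_⟩
  rw [Real.dist_0_eq_abs, abs_of_nonneg (dH_nonneg _ _)]
  have h1 := hp (u' n) (hN n hn)
  have h2 := hp ⟨a, haL⟩ (hmax ▸ hbs)
  have h3 := dH_triangle (u' n : V) p a
  rw [dH_comm (u' n : V) p] at h3
  exact h3.trans_lt (by linarith)

end Gap

/-! ### Peaking finite rank operators from property (P) -/

section FiniteRank

variable {X Y : Type*} [NormedAddCommGroup X] [NormedSpace ℝ X]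
  [NormedAddCommGroup Y] [NormedSpace ℝ Y]

/-- The space of finite rank operators. -/
def finiteRankOperators (X Y : Type*) [NormedAddCommGroup X] [NormedSpace ℝ X]
    [NormedAddCommGroup Y] [NormedSpace ℝ Y] : Submodule ℝ (X →L[ℝ] Y) where
  carrier := {T | IsFiniteRank T}
  add_mem' := by
    intro S T hS hT
    have : FiniteDimensional ℝ (LinearMap.range (S : X →ₗ[ℝ] Y)) := hS
    have : FiniteDimensional ℝ (LinearMap.range (T : X →ₗ[ℝ] Y)) := hT
    refine Submodule.finiteDimensional_of_le (S₂ := LinearMap.range (S : X →ₗ[ℝ] Y) ⊔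
      LinearMap.range (T : X →ₗ[ℝ] Y)) ?_
    rintro _ ⟨x, rfl⟩
    exact Submodule.add_mem_sup ⟨x, rfl⟩ ⟨x, rfl⟩
  zero_mem' := by
    refine Submodule.finiteDimensional_of_le (S₂ := (⊥ : Submodule ℝ Y)) ?_
    rintro _ ⟨x, rfl⟩
    simp
  smul_mem' := by
    intro c T hT
    have : FiniteDimensional ℝ (LinearMap.range (T : X →ₗ[ℝ] Y)) := hT
    refine Submodule.finiteDimensional_of_le (S₂ := LinearMap.range (T : X →ₗ[ℝ] Y)) ?_
    rintro _ ⟨x, rfl⟩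
    exact Submodule.smul_mem _ c ⟨x, rfl⟩

theorem smulRight_mem_finiteRankOperators (f : StrongDual ℝ X) (y : Y) :
    f.smulRight y ∈ finiteRankOperators X Y := by
  refine Submodule.finiteDimensional_of_le (S₂ := Submodule.span ℝ {y}) ?_
  rintro _ ⟨x, rfl⟩
  exact Submodule.smul_mem _ _ (Submodule.mem_span_singleton_self y)

/-- The restriction to `L` of the function `(x, y*) ↦ y*(T x)`. -/
def evalPair (L : Set (PairSpace X Y)) : finiteRankOperators X Y →ₗ[ℝ] (L → ℝ) where
  toFun T p := p.1.snd (T.1 p.1.fst)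
  map_add' S T := by ext p; simp
  map_smul' c T := by ext p; simp

theorem abs_evalPair_le {L : Set (PairSpace X Y)} (hL : L ⊆ spheres X Y)
    (T : finiteRankOperators X Y) (p : L) : |evalPair L T p| ≤ ‖T‖ := by
  obtain ⟨h1, h2⟩ := hL p.2
  have h3 := p.1.snd.le_opNorm (T.1 p.1.fst)
  have h4 := T.1.le_opNorm p.1.fst
  rw [h2, one_mul] at h3
  rw [h1, mul_one] at h4
  exact h3.trans h4

theorem exists_lt_apply_of_norm_eq_one {g : StrongDual ℝ Y} (hg : ‖g‖ = 1) {η : ℝ} (hη : 0 < η) :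
    ∃ v : Y, ‖v‖ ≤ 1 ∧ 1 - η < g v := by
  by_contra! h
  have hη1 : 0 ≤ 1 - η := by simpa using h 0 (by simp)
  have : ‖g‖ ≤ 1 - η := by
    refine ContinuousLinearMap.opNorm_le_of_unit_norm hη1 fun v hv => ?_
    rw [Real.norm_eq_abs, abs_le]
    have h1 := h v hv.le
    have h2 := h (-v) (by rw [norm_neg, hv])
    rw [map_neg] at h2
    constructor <;> linarith
  linarith

theorem exists_supporting {L : Set (PairSpace X Y)} (hL : L ⊆ spheres X Y) (p : L) {η : ℝ}
    (hη : 0 < η) : ∃ (u : StrongDual ℝ X) (v : Y), ‖u‖ ≤ 1 ∧ ‖v‖ ≤ 1 ∧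
      u p.1.fst = 1 ∧ 1 - η < p.1.snd v ∧ p.1.snd v ≤ 1 := by
  obtain ⟨h1, h2⟩ := hL p.2
  obtain ⟨u, hu, hux⟩ := exists_dual_vector'' ℝ p.1.fst
  obtain ⟨v, hv, hpv⟩ := exists_lt_apply_of_norm_eq_one h2 hη
  refine ⟨u, v, hu, hv, by simpa [h1] using hux, hpv, ?_⟩
  have h3 := p.1.snd.le_opNorm v
  rw [h2, one_mul] at h3
  exact (le_abs_self _).trans (h3.trans hv)

theorem norm_smulRight_le_one {f : StrongDual ℝ X} {y : Y} (hf : ‖f‖ ≤ 1) (hy : ‖y‖ ≤ 1) :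
    ‖f.smulRight y‖ ≤ 1 := by
  rw [ContinuousLinearMap.norm_smulRight_apply]
  exact mul_le_one₀ hf (norm_nonneg _) hy

theorem exists_half_le_abs_evalPair {L : Set (PairSpace X Y)} (hL : L ⊆ spheres X Y) (p : L) :
    ∃ R : finiteRankOperators X Y, ‖R‖ ≤ 1 ∧ 1 / 2 ≤ |evalPair L R p| := by
  obtain ⟨u, v, hu, hv, hux, hpv, -⟩ := exists_supporting hL p (half_pos one_pos)
  refine ⟨⟨u.smulRight v, smulRight_mem_finiteRankOperators u v⟩, norm_smulRight_le_one hu hv, ?_⟩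
  refine le_trans ?_ (le_abs_self _)
  simp only [evalPair, LinearMap.coe_mk, AddHom.coe_mk, ContinuousLinearMap.smulRight_apply,
    map_smul, smul_eq_mul, hux, one_mul]
  linarith

theorem PropertyP.exists_peaking {L : Set (PairSpace X Y)} (hP : PropertyP L)
    (hL : L ⊆ spheres X Y) {δ : ℝ} (hδ : 0 < δ) :
    ∃ δ' > 0, δ' ≤ δ ∧ ∃ c > 0, ∀ p : L, ∃ R : finiteRankOperators X Y, ‖R‖ ≤ 1 ∧
      ∀ q : L, δ' ≤ dH p.1 q.1 → |evalPair L R q| + c ≤ evalPair L R p := by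
  obtain ⟨ε₀, hε₀, hP⟩ := hP
  refine ⟨min δ (ε₀ / 2), by positivity, min_le_left _ _, ?_⟩
  obtain ⟨ϖ, hϖ, hP⟩ := hP (min δ (ε₀ / 2)) (by positivity)
    ((min_le_right _ _).trans_lt (by linarith))
  refine ⟨ϖ / 4, by positivity, fun p => ?_⟩
  obtain ⟨f, y, hf, hy, hfy⟩ := hP p.1 p.2
  obtain ⟨u, v, hu, hv, hux, hpv, hpv'⟩ := exists_supporting hL p (half_pos hϖ)
  -- Pairing `f` with an almost norming `v`, and `y` with a norming `u`, makes the value of `R` at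
  -- `p` nearly half of `f p.1.fst + p.1.snd y`, while elsewhere it is at most half of the sum of
  -- absolute values in (P).
  let R : X →L[ℝ] Y := (1 / 2 : ℝ) • (f.smulRight v + u.smulRight y)
  have hRmem : R ∈ finiteRankOperators X Y :=
    Submodule.smul_mem _ _ (add_mem (smulRight_mem_finiteRankOperators f v)
      (smulRight_mem_finiteRankOperators u y))
  have hval : ∀ q : L, evalPair L ⟨R, hRmem⟩ q =
      (f q.1.fst * q.1.snd v + u q.1.fst * q.1.snd y) / 2 := by
    intro q
    simp [evalPair, R]
    ring
  have hle : ∀ (g : StrongDual ℝ X), ‖g‖ ≤ 1 → ∀ q : L, |g q.1.fst| ≤ 1 := by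
    intro g hg q
    have := g.le_of_opNorm_le hg q.1.fst
    rwa [(hL q.2).1, mul_one] at this
  refine ⟨⟨R, hRmem⟩, ?_, fun q hq => ?_⟩
  · change ‖R‖ ≤ 1
    rw [norm_smul, Real.norm_of_nonneg (by norm_num)]
    have h1 := norm_add_le (f.smulRight v) (u.smulRight y)
    have h2 := norm_smulRight_le_one hf hv
    have h3 := norm_smulRight_le_one hu hy
    linarith
  · have h1 := hfy q.1 q.2 hq
    rw [hval, hval, hux, one_mul, abs_div, abs_two]
    have h2 : |f q.1.fst * q.1.snd v + u q.1.fst * q.1.snd y| ≤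
        |f q.1.fst| + |q.1.snd y| := by
      refine (abs_add_le _ _).trans (add_le_add ?_ ?_)
      · rw [abs_mul]
        refine mul_le_of_le_one_right (abs_nonneg _) ?_
        have := q.1.snd.le_opNorm v
        rw [(hL q.2).2, one_mul] at this
        exact this.trans hv
      · rw [abs_mul]
        exact mul_le_of_le_one_left (abs_nonneg _) (hle u hu q)
    have h3 : f p.1.fst - ϖ / 2 ≤ f p.1.fst * p.1.snd v := by
      have h4 : f p.1.fst * (1 - p.1.snd v) ≤ 1 * (1 - p.1.snd v) :=
        mul_le_mul_of_nonneg_right ((le_abs_self _).trans (hle f hf p)) (by linarith)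
      linarith
    linarith

end FiniteRank

/-! ### Density and the Baire argument -/

section Main

variable {X Y W Z : Type*} [NormedAddCommGroup X] [NormedSpace ℝ X]
  [NormedAddCommGroup Y] [NormedSpace ℝ Y]
  [NormedAddCommGroup W] [NormedSpace ℝ W] [Nontrivial W]
  [NormedAddCommGroup Z] [NormedSpace ℝ Z] {L : Set (PairSpace X Y)}

theorem exists_hasGap_near (hLne : L.Nonempty) (hLsub : L ⊆ spheres X Y) (hLP : PropertyP L)
    (ι : Z →ₗ[ℝ] evenBCF L W) (hι : Function.Injective ι)
    (hcontains : ∀ (T : X →L[ℝ] Y) (w : W), IsFiniteRank T →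
      ∃ z : Z, (∀ p : L, (ι z).1 p = oplus T w p.1) ∧ ‖z‖ ≤ ‖T‖ * ‖w‖)
    (θ : Z) {z₀ : Z} (hz₀ : z₀ ∈ finiteRankOplus ι) {δ ρ : ℝ} (hδ : 0 < δ) (hρ : 0 < ρ) :
    ∃ z ∈ finiteRankOplus ι, ‖z - z₀‖ < ρ ∧ HasGap (ι (θ + z)).1 δ := by
  obtain ⟨T₀, w₀, hT₀, hz₀⟩ := hz₀
  obtain ⟨δ', hδ', hδδ', c, hc, hR⟩ := hLP.exists_peaking hLsub hδ
  have : Nonempty L := hLne.to_subtype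
  obtain ⟨r, hr, hr1, hrρ⟩ : ∃ r > 0, r ≤ 1 ∧ r * (‖w₀‖ + 1) + ‖T₀‖ * r < ρ := by
    refine ⟨min 1 (ρ / (2 * (‖w₀‖ + 1 + ‖T₀‖))), by positivity, min_le_left _ _, ?_⟩
    calc _ = min 1 (ρ / (2 * (‖w₀‖ + 1 + ‖T₀‖))) * (‖w₀‖ + 1 + ‖T₀‖) := by ring
      _ ≤ ρ / (2 * (‖w₀‖ + 1 + ‖T₀‖)) * (‖w₀‖ + 1 + ‖T₀‖) := by
        gcongr
        exact min_le_right _ _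
      _ = ρ / 2 := by field_simp
      _ < ρ := half_lt_self hρ
  obtain ⟨T, w, hT, hw, p, γ, hγ, hgap⟩ := @exists_gap L (finiteRankOperators X Y) W
    inferInstance inferInstance inferInstance inferInstance
    (fun p => (ι θ).1 p) (evalPair L) _ _
    ⟨‖(ι θ).1‖, (ι θ).1.norm_coe_le_norm⟩ (abs_evalPair_le hLsub) (fun p q => δ' ≤ dH p.1 q.1)
    c (1 / 2) hc one_half_pos hR
    (exists_half_le_abs_evalPair hLsub) ⟨T₀, hT₀⟩ w₀ r hr
  obtain ⟨z, hz, -⟩ := hcontains T.1 w T.2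
  obtain ⟨a, ha, han⟩ := hcontains (T.1 - T₀) w ((finiteRankOperators X Y).sub_mem T.2 hT₀)
  obtain ⟨b, hb, hbn⟩ := hcontains T₀ (w - w₀) hT₀
  refine ⟨z, ⟨T.1, w, T.2, hz⟩, ?_, HasGap.mono ⟨p, γ, hγ, fun q hq => ?_⟩ hδδ'⟩
  -- Split `T ⊗ w - T₀ ⊗ w₀` as `(T - T₀) ⊗ w + T₀ ⊗ (w - w₀)`, each term being an elementary tensor
  -- with controlled norm.
  · have hzab : z - z₀ = a + b := by
      apply hι
      apply Subtype.ext
      ext q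
      simp only [map_sub, map_add, Submodule.coe_sub, Submodule.coe_add,
        BoundedContinuousFunction.sub_apply, BoundedContinuousFunction.add_apply,
        hz, hz₀, ha, hb, oplus, _root_.sub_apply, sub_smul, smul_sub]
      abel
    rw [hzab]
    refine (norm_add_le a b).trans_lt (lt_of_le_of_lt (add_le_add han hbn) ?_)
    have h1 : ‖w‖ ≤ ‖w₀‖ + 1 := by
      have := norm_le_norm_add_norm_sub' w w₀
      linarith
    have h2 : ‖T.1 - T₀‖ * ‖w‖ ≤ r * (‖w₀‖ + 1) :=
      mul_le_mul (le_of_lt hT) h1 (norm_nonneg _) hr.le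
    have h3 : ‖T₀‖ * ‖w - w₀‖ ≤ ‖T₀‖ * r := by gcongr
    linarith
  · have hv : ∀ q : L, (ι (θ + z)).1 q = perturb (fun p => (ι θ).1 p) (evalPair L) T w q := by
      intro q
      simp [perturb, hz, oplus, evalPair]
    rw [hv, hv]
    exact hgap q hq

end Main

end StrongMax

theorem corollary3p10
    {X Y W Z : Type*}
    [NormedAddCommGroup X] [NormedSpace ℝ X] [CompleteSpace X]
    [NormedAddCommGroup Y] [NormedSpace ℝ Y] [CompleteSpace Y]
    [NormedAddCommGroup W] [NormedSpace ℝ W] [CompleteSpace W] [Nontrivial W]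
    (L : Set (StrongMax.PairSpace X Y))
    (hLne : L.Nonempty) (hLsymm : StrongMax.IsSymmetric L) (hLclosed : IsClosed L)
    (hLsub : L ⊆ StrongMax.spheres X Y) (hLP : StrongMax.PropertyP L)
    -- the Banach space `Z`, included in `C_{b,e}(L, W)` by the linear injection `ι`
    [NormedAddCommGroup Z] [NormedSpace ℝ Z] [CompleteSpace Z]
    (ι : Z →ₗ[ℝ] StrongMax.evenBCF L W) (hι : Function.Injective ι)
    (hnorm : ∀ z : Z, ‖ι z‖ ≤ ‖z‖)
    (hcontains : ∀ (T : X →L[ℝ] Y) (w : W), StrongMax.IsFiniteRank T →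
      ∃ z : Z, (∀ p : L, (ι z).1 p = StrongMax.oplus T w p.1) ∧ ‖z‖ ≤ ‖T‖ * ‖w‖)
    (Θ : ℕ → Z) (ε : ℝ) (hε : 0 < ε) :
    ∃ Φ ∈ closure (StrongMax.finiteRankOplus ι), ‖Φ‖ < ε ∧
      ∀ n : ℕ, StrongMax.AttainsDHStrongly (ι (Θ n + Φ)).1 := by
  let S : Set Z := closure (StrongMax.finiteRankOplus ι)
  have : CompleteSpace S := isClosed_closure.completeSpace_coe
  -- Countably many conditions, one for each function of the sequence and each scale `1 / (k + 1)`.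
  let G : ℕ × ℕ → Set S := fun i =>
    {Φ | StrongMax.HasGap (ι (Θ i.1 + Φ.1)).1 (1 / ((i.2 : ℝ) + 1))}
  have hGopen : ∀ i, IsOpen (G i) := by
    intro i
    rw [Metric.isOpen_iff]
    intro Φ hΦ
    obtain ⟨ρ, hρ, h⟩ := StrongMax.HasGap.exists_forall_norm_sub_lt hΦ
    refine ⟨ρ, hρ, fun Ψ hΨ => h _ ?_⟩
    rw [← Submodule.coe_sub, ← map_sub, add_sub_add_left_eq_sub]
    refine (hnorm _).trans_lt ?_
    rwa [← dist_eq_norm]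
  have hGdense : ∀ i, Dense (G i) := by
    intro i
    rw [Metric.dense_iff]
    intro Φ ρ hρ
    obtain ⟨z₀, hz₀, hd⟩ := Metric.mem_closure_iff.1 Φ.2 (ρ / 2) (half_pos hρ)
    obtain ⟨z, hz, hzz₀, hgap⟩ := StrongMax.exists_hasGap_near hLne hLsub hLP ι hι hcontains
      (Θ i.1) hz₀ (Nat.one_div_pos_of_nat (n := i.2)) (half_pos hρ)
    refine ⟨⟨z, subset_closure hz⟩, ?_, hgap⟩
    rw [Metric.mem_ball, Subtype.dist_eq]
    rw [← dist_eq_norm] at hzz₀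
    rw [dist_comm] at hd
    have := dist_triangle z z₀ Φ.1
    change dist z Φ.1 < ρ
    linarith
  have h0 : (0 : Z) ∈ S := by
    refine subset_closure ⟨0, 0, (StrongMax.finiteRankOperators X Y).zero_mem, fun p => ?_⟩
    simp [StrongMax.oplus]
  obtain ⟨Φ, hΦ, hΦε⟩ := (dense_iInter_of_isOpen hGopen hGdense).exists_dist_lt ⟨0, h0⟩ hε
  rw [Set.mem_iInter] at hΦ
  refine ⟨Φ.1, Φ.2, ?_, fun n => ?_⟩
  · rwa [dist_comm, Subtype.dist_eq, dist_zero_right] at hΦε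
  · refine StrongMax.attainsDHStrongly_of_hasGap hLclosed fun δ hδ => ?_
    obtain ⟨k, hk⟩ := exists_nat_one_div_lt hδ
    exact StrongMax.HasGap.mono (hΦ (n, k)) hk.le
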